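/- Let $(X,\mathcal X)$ be a Polish space with its Borel $\sigma$-algebra, $\pi_0$ a probability measure on $X$, $f$ a Markov transition kernel on $X$, and $(g_n)_{n\ge 0}$ a sequence of bounded, measurable, strictly positive functions on $X$ (for instance $g_n(x)=g(x,y_n)$, the likelihood of a fixed observation $y_n$). The prediction filters are given by $\pi_0$ and $$\pi_{n+1}(A)=\frac{\int g_n(x)f(x,A)\,\pi_n(dx)}{\int g_n(x)\,\pi_n(dx)},\qquad n\ge 0 .$$ For integers $M,m\ge 1$ put $N=Mm$, $G_k=\{(k-1)M+1,\dots,kM\}$ for $1\le k\le m$, and let $L$ be a map $i\mapsto L^i$ from $\{1,\dots,N\}$ to itself. The particle filter with index map $L$ starts with $W_0^i=1$ and $\zeta_0^1,\dots,\zeta_0^N$ independent with law $\pi_0$. For $n\ge 1$, $1\le k\le m$ and $i\in G_k$, $$W_n^i=\frac1{Mm}\sum_{j\in G_k}W_{n-1}^{L^j}g_{n-1}(\zeta_{n-1}^{L^j}),$$ and, given $\zeta_0,\dots,\zeta_{n-1}$, the particles $\zeta_n^1,\dots,\zeta_n^N$ are conditionally independent, with $$\zeta_n^i\sim\frac{\sum_{j\in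 G_k}W_{n-1}^{L^j}g_{n-1}(\zeta_{n-1}^{L^j})\,f(\zeta_{n-1}^{L^j},\cdot)}{\sum_{j\in G_k}W_{n-1}^{L^j}g_{n-1}(\zeta_{n-1}^{L^j})},\qquad i\in G_k .$$ The local exchange particle filter (LEPF) with parameter $\theta\in\{1,\dots,M-1\}$ is the case where $L^i$ is the element of $\{1,\dots,N\}$ congruent to $i+\theta$ modulo $N$; the $m$ independent bootstrap particle filters (IBPF) are the case $L^i=i$. Write $$\pi_n^{Mm}(\varphi)=\frac{\sum_iW_n^i\varphi(\zeta_n^i)}{\sum_iW_n^i},\qquad \mathcal E_n^{Mm}=\frac{\big(\frac1N\sum_iW_n^i\big)^2}{\frac1N\sum_i(W_n^i)^2}.$$ Assume that there are $\delta,\epsilon\in[1,\infty)$ with $$\sup_{n\ge0}\sup_{x,y}\frac{g_n(x)}{g_n(y)}\le\delta\qquad\text{and}\qquad f(x,\cdot)\le\epsilon f(y,\cdot)\quad\text{for all }x,y\in X,$$ and fix $m\ge1$. Then, for every bounded measurable $\varphi:X\to\mathbb R$ and every real $p\ge1$, $$\sup_{M}\sup_{n\ge0}\sqrt M\;\mathbb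 E\big[|\pi_n^{Mm}(\varphi)-\pi_n(\varphi)|^p\big]^{1/p}<\infty ,$$ both for the IBPF, with the supremum over $M\ge1$, and for the LEPF, with the supremum over $M\ge2$ and also over $\theta\in\{1,\dots,M-1\}$. Moreover, for both algorithms, $\mathcal E_n^{Mm}\ge 1/m$ for all admissible $M$ (and $\theta$) and all $n\ge0$, for every realization of the particles. -/

import Mathlib

open MeasureTheory ProbabilityTheory
open scoped NNReal ENNReal

namespace ParticleFilter

noncomputable section

variable {X : Type*} [MeasurableSpace X]

/-- The prediction filter update
`Φ(μ)(A) = (∫ g(x) f(x, A) μ(dx)) / (∫ g(x) μ(dx))`. -/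
def filterStep (f : Kernel X X) (g : X → ℝ) (μ : Measure X) : Measure X :=
  (∫⁻ x, ENNReal.ofReal (g x) ∂μ)⁻¹ •
    (μ.withDensity fun x => ENNReal.ofReal (g x)).bind f

/-- The prediction filters `π_0, π_1, …`, where `π_{n+1}` is obtained from `π_n` and `g_n`. -/
def predictionFilter (π₀ : Measure X) (f : Kernel X X) (g : ℕ → X → ℝ) : ℕ → Measure X
  | 0 => π₀
  | n + 1 => filterStep f (g n) (predictionFilter π₀ f g n)

/-- The strong mixing conditions: for some `δ, ε ∈ [1, ∞)`,
`g_n(x) / g_n(y) ≤ δ` for all `n, x, y`, and `f(x, ·) ≤ ε f(y, ·)` for all `x, y`. -/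
def StrongMixing (f : Kernel X X) (g : ℕ → X → ℝ) : Prop :=
  ∃ δ ε : ℝ, 1 ≤ δ ∧ 1 ≤ ε ∧
    (∀ n x y, g n x / g n y ≤ δ) ∧
    (∀ x y, f x ≤ ENNReal.ofReal ε • f y)

/-- The particles are indexed by `0, …, M m - 1`; the group of the particle `i` consists of the
particles `j` with `⌊j / M⌋ = ⌊i / M⌋`. There are `m` groups of `M` particles each. -/
def group (M m : ℕ) (i : Fin (M * m)) : Finset (Fin (M * m)) :=
  Finset.univ.filter fun j => (j : ℕ) / M = (i : ℕ) / M

/-- The local exchange map `i ↦ (i + θ) mod M m`. -/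
def localExchange (M m θ : ℕ) (i : Fin (M * m)) : Fin (M * m) :=
  ⟨((i : ℕ) + θ) % (M * m), Nat.mod_lt _ i.pos⟩

/-- The weights `W_n^i` along the particle path `z`, for the index map `L`:
`W_0^i = 1` and `W_{n+1}^i = (M m)⁻¹ ∑_j W_n^{L j} g_n(z_n^{L j})`,
summed over the group of `i`. -/
def weight (g : ℕ → X → ℝ) (M m : ℕ) (L : Fin (M * m) → Fin (M * m))
    (z : ℕ → Fin (M * m) → X) : ℕ → Fin (M * m) → ℝ
  | 0, _ => 1
  | n + 1, i => ((M * m : ℕ) : ℝ)⁻¹ *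
      ∑ j ∈ group M m i, weight g M m L z n (L j) * g n (z n (L j))

/-- The distribution from which the `i`-th particle at time `n + 1` is sampled, given the
particles up to time `n`: the normalization of
`∑_j W_n^{L j} g_n(z_n^{L j}) f(z_n^{L j}, ·)`, summed over the group of `i`. -/
def proposal (f : Kernel X X) (g : ℕ → X → ℝ) (M m : ℕ) (L : Fin (M * m) → Fin (M * m))
    (z : ℕ → Fin (M * m) → X) (n : ℕ) (i : Fin (M * m)) : Measure X :=
  ∑ j ∈ group M m i,
    ENNReal.ofReal (weight g M m L z n (L j) * g n (z n (L j)) /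
      ∑ l ∈ group M m i, weight g M m L z n (L l) * g n (z n (L l))) • f (z n (L j))

/-- The random variables `ζ_n^i` are the particles of the grouped particle filter with index
map `L`: the `ζ_0^i` are independent with law `π₀`, and, given `ζ_0, …, ζ_n`, the `ζ_{n+1}^i`
are conditionally independent and distributed according to their proposals. -/
structure IsGroupedFilter (π₀ : Measure X) (f : Kernel X X) (g : ℕ → X → ℝ) (M m : ℕ)
    (L : Fin (M * m) → Fin (M * m)) {Ω : Type*} [MeasurableSpace Ω] (P : Measure Ω)
    (ζ : ℕ → Fin (M * m) → Ω → X) : Prop where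
  measurable : ∀ n i, Measurable (ζ n i)
  initial : P.map (fun ω i => ζ 0 i ω) = Measure.pi fun _ => π₀
  step : ∀ (n : ℕ) (A : Fin (M * m) → Set X), (∀ i, MeasurableSet (A i)) →
    P[Set.indicator {ω | ∀ i, ζ (n + 1) i ω ∈ A i} (fun _ => (1 : ℝ)) |
        ⨆ k ≤ n, ⨆ i, MeasurableSpace.comap (ζ k i) inferInstance]
      =ᵐ[P] fun ω => ∏ i, (proposal f g M m L (fun k j => ζ k j ω) n i).real (A i)

/-- The particles of the local exchange particle filter with exchange parameter `θ`. -/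
def IsLEPF (π₀ : Measure X) (f : Kernel X X) (g : ℕ → X → ℝ) (M m θ : ℕ)
    {Ω : Type*} [MeasurableSpace Ω] (P : Measure Ω) (ζ : ℕ → Fin (M * m) → Ω → X) : Prop :=
  IsGroupedFilter π₀ f g M m (localExchange M m θ) P ζ

/-- The particles of `m` independent bootstrap particle filters with `M` particles each. -/
def IsIBPF (π₀ : Measure X) (f : Kernel X X) (g : ℕ → X → ℝ) (M m : ℕ)
    {Ω : Type*} [MeasurableSpace Ω] (P : Measure Ω) (ζ : ℕ → Fin (M * m) → Ω → X) : Prop :=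
  IsGroupedFilter π₀ f g M m id P ζ

/-- The integral of `φ` against the weighted empirical measure
`(∑_i W_n^i δ_{z_n^i}) / (∑_i W_n^i)`. -/
def estimate (g : ℕ → X → ℝ) (M m : ℕ) (L : Fin (M * m) → Fin (M * m))
    (z : ℕ → Fin (M * m) → X) (n : ℕ) (φ : X → ℝ) : ℝ :=
  (∑ i, weight g M m L z n i * φ (z n i)) / ∑ i, weight g M m L z n i

/-- The effective sample fraction
`ℰ_n = (N⁻¹ ∑_i W_n^i)² / (N⁻¹ ∑_i (W_n^i)²)` with `N = M m`. -/
def effectiveFraction (g : ℕ → X → ℝ) (M m : ℕ) (L : Fin (M * m) → Fin (M * m))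
    (z : ℕ → Fin (M * m) → X) (n : ℕ) : ℝ :=
  (((M * m : ℕ) : ℝ)⁻¹ * ∑ i, weight g M m L z n i) ^ 2 /
    (((M * m : ℕ) : ℝ)⁻¹ * ∑ i, weight g M m L z n i ^ 2)

end

end ParticleFilter

/-!
The proof follows the filter flow. Write `Φ_n` for one step of the filter, `η_n` for the weighted
empirical measure of the particles and `π_n` for the prediction filter.

*Sampling.* For a bijective index map `L`, the proposals average, with the weights of time `n +
1`, to `Φ_n(η_n)` (`sum_weight_mul_integral_proposal`): each group passes on its share of the
total mass, and the exchange only permutes the summands. Given the past, `η_{n+1}(h) -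
Φ_n(η_n)(h)` is therefore a sum of independent centred variables with the normalized weights as
coefficients. Weights are constant on groups of `M` particles, so the squares of the normalized
weights sum to at most `1 / M` (`mul_sum_weight_sq_le`). This is the lower bound `1 / m` for the
effective sample fraction, and by Hoeffding's lemma it bounds the error of one sampling step in
`L^p` by a multiple of `M ^ (-1/2)`, no matter how uneven the weights of different groups are
(`lintegral_empirical_succ_le`).

*Stability.* The flow `Φ_{k+j-1} ∘ ⋯ ∘ Φ_k` is the normalization of the linear semigroup `Q_k ⋯
Q_{k+j-1}`, `Q_n φ = g_n · f φ`. Strong mixing makes the normalized semigroup contract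
oscillations by a factor `ρ = 1 - ε⁻² < 1` per step, while the potentials `Q_k ⋯ Q_{k+j-1} 1` vary
at most by the factor `δ ε`. Hence the distance of the flows from two initial measures `μ`, `ν` is
at most `C ρ ^ j` times `|(μ - ν)(h₁)| + |(μ - ν)(h₂)|`, where the test functions `h₁`, `h₂` do
not depend on `μ` and `ν` (`exists_abs_integral_flow_sub_le`), so that `μ` and `ν` may be random.

The error at time `n` is the sum of the sampling errors of the times `k ≤ n`, each propagated by
the flow for `n - k` steps, and the geometric series gives a bound uniform in time
(`eLpNorm_flow_empirical_sub_le`).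
-/

namespace ParticleFilter

section

/-! ### Test functions -/

/-- Bounded measurable real functions, the class of test functions. -/
structure IsTestFunction {X : Type*} [MeasurableSpace X] (φ : X → ℝ) : Prop where
  measurable : Measurable φ
  bounded : ∃ B : ℝ, ∀ x, |φ x| ≤ B

namespace IsTestFunction

variable {X : Type*} [MeasurableSpace X] {φ ψ : X → ℝ}

lemma integrable (h : IsTestFunction φ) (μ : Measure X) [IsFiniteMeasure μ] :
    Integrable φ μ := by
  obtain ⟨B, hB⟩ := h.bounded
  exact Integrable.of_bound h.measurable.aestronglyMeasurable B (.of_forall hB)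

lemma const (c : ℝ) : IsTestFunction fun _ : X => c :=
  ⟨measurable_const, |c|, fun _ => le_rfl⟩

lemma mul (h : IsTestFunction φ) (h' : IsTestFunction ψ) :
    IsTestFunction fun x => φ x * ψ x := by
  obtain ⟨B, hB⟩ := h.bounded
  obtain ⟨B', hB'⟩ := h'.bounded
  refine ⟨h.measurable.mul h'.measurable, B * B', fun x => ?_⟩
  rw [abs_mul]
  exact mul_le_mul (hB x) (hB' x) (abs_nonneg _) ((abs_nonneg _).trans (hB x))

lemma sub (h : IsTestFunction φ) (h' : IsTestFunction ψ) :
    IsTestFunction fun x => φ x - ψ x := by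
  obtain ⟨B, hB⟩ := h.bounded
  obtain ⟨B', hB'⟩ := h'.bounded
  exact ⟨h.measurable.sub h'.measurable, B + B', fun x =>
    (abs_sub _ _).trans (add_le_add (hB x) (hB' x))⟩

lemma integral_kernel (h : IsTestFunction φ) (f : Kernel X X) [IsMarkovKernel f] :
    IsTestFunction fun x => ∫ y, φ y ∂(f x) := by
  obtain ⟨B, hB⟩ := h.bounded
  refine ⟨h.measurable.stronglyMeasurable.integral_kernel.measurable, B, fun x => ?_⟩
  simpa using norm_integral_le_of_norm_le_const (μ := f x) (f := φ) (C := B) (.of_forall hB)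

end IsTestFunction

variable {X : Type*} [MeasurableSpace X]

/-! ### The unnormalized semigroup and the filter flow -/

/-- The unnormalized one-step operator `Qφ(x) = g(x) ∫ φ(y) f(x, dy)`. -/
noncomputable def fkStep (f : Kernel X X) (g φ : X → ℝ) (x : X) : ℝ := g x * ∫ y, φ y ∂(f x)

/-- The unnormalized semigroup `Q_k Q_{k+1} ⋯ Q_{k+j-1} φ` of `j` steps that start at time `k`. -/
noncomputable def fkIter (f : Kernel X X) (g : ℕ → X → ℝ) (φ : X → ℝ) : ℕ → ℕ → X → ℝ
  | _, 0 => φ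
  | k, j + 1 => fkStep f (g k) (fkIter f g φ (k + 1) j)

/-- The filter flow: `j` applications of `filterStep`, the first of them with `g_k`. -/
noncomputable def flow (f : Kernel X X) (g : ℕ → X → ℝ) : ℕ → ℕ → Measure X → Measure X
  | _, 0, μ => μ
  | k, j + 1, μ => flow f g (k + 1) j (filterStep f (g k) μ)

variable {f : Kernel X X} [IsMarkovKernel f]

lemma IsTestFunction.fkStep {φ g : X → ℝ} (hg : IsTestFunction g) (hφ : IsTestFunction φ) :
    IsTestFunction (fkStep f g φ) :=
  hg.mul (hφ.integral_kernel f)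

lemma IsTestFunction.fkIter {φ : X → ℝ} {g : ℕ → X → ℝ} (hg : ∀ n, IsTestFunction (g n))
    (hφ : IsTestFunction φ) (k j : ℕ) : IsTestFunction (fkIter f g φ k j) := by
  induction j generalizing k with
  | zero => exact hφ
  | succ j ih => exact (hg k).fkStep (ih _)

lemma integral_pos_of_isTestFunction {g : X → ℝ} (hg : IsTestFunction g) (hpos : ∀ x, 0 < g x)
    (μ : Measure X) [IsProbabilityMeasure μ] : 0 < ∫ x, g x ∂μ := by
  rw [integral_pos_iff_support_of_nonneg (fun x => (hpos x).le) (hg.integrable μ)]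
  have : Function.support g = Set.univ := by
    ext x; simp [(hpos x).ne']
  simp [this]

lemma isProbabilityMeasure_filterStep {g : X → ℝ} (hg : IsTestFunction g) (hpos : ∀ x, 0 < g x)
    (μ : Measure X) [IsProbabilityMeasure μ] : IsProbabilityMeasure (filterStep f g μ) := by
  have h0 : ∫⁻ x, ENNReal.ofReal (g x) ∂μ = ENNReal.ofReal (∫ x, g x ∂μ) :=
    (ofReal_integral_eq_lintegral_ofReal (hg.integrable μ) (.of_forall fun x => (hpos x).le)).symm
  have hp := integral_pos_of_isTestFunction hg hpos μ
  constructor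
  rw [filterStep, Measure.smul_apply, Measure.bind_apply .univ f.aemeasurable]
  simp only [measure_univ, lintegral_const, one_mul, withDensity_apply _ MeasurableSet.univ,
    Measure.restrict_univ, smul_eq_mul]
  rw [h0]
  exact ENNReal.inv_mul_cancel (by simpa using hp) ENNReal.ofReal_ne_top

lemma integral_bind_eq {φ : X → ℝ} (hφ : IsTestFunction φ) (μ : Measure X) [IsFiniteMeasure μ] :
    ∫ x, φ x ∂(μ.bind f) = ∫ x, ∫ y, φ y ∂(f x) ∂μ := by
  rw [← Measure.snd_compProd, Measure.snd, integral_map measurable_snd.aemeasurable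
    hφ.measurable.aestronglyMeasurable]
  obtain ⟨B, hB⟩ := hφ.bounded
  exact Measure.integral_compProd (Integrable.of_bound
    (hφ.measurable.comp measurable_snd).aestronglyMeasurable B (.of_forall fun p => hB p.2))

lemma integral_filterStep {g φ : X → ℝ} (hg : IsTestFunction g) (hpos : ∀ x, 0 < g x)
    (hφ : IsTestFunction φ) (μ : Measure X) [IsProbabilityMeasure μ] :
    ∫ x, φ x ∂(filterStep f g μ) = (∫ x, fkStep f g φ x ∂μ) / ∫ x, g x ∂μ := by
  have h0 : ∫⁻ x, ENNReal.ofReal (g x) ∂μ = ENNReal.ofReal (∫ x, g x ∂μ) :=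
    (ofReal_integral_eq_lintegral_ofReal (hg.integrable μ) (.of_forall fun x => (hpos x).le)).symm
  have hp := integral_pos_of_isTestFunction hg hpos μ
  have : IsFiniteMeasure (μ.withDensity fun x => ENNReal.ofReal (g x)) :=
    isFiniteMeasure_withDensity (by rw [h0]; exact ENNReal.ofReal_ne_top)
  rw [filterStep, integral_smul_measure, integral_bind_eq hφ,
    integral_withDensity_eq_integral_toReal_smul hg.measurable.ennreal_ofReal (by simp), h0]
  simp only [ENNReal.toReal_inv, ENNReal.toReal_ofReal hp.le, smul_eq_mul,
    fun x => ENNReal.toReal_ofReal (hpos x).le, fkStep]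
  rw [div_eq_inv_mul]

lemma fkIter_one_pos {g : ℕ → X → ℝ} (hg : ∀ n, IsTestFunction (g n)) (hpos : ∀ n x, 0 < g n x)
    (k j : ℕ) (x : X) : 0 < fkIter f g (fun _ => 1) k j x := by
  induction j generalizing k x with
  | zero => simp [fkIter]
  | succ j ih =>
    exact mul_pos (hpos k x)
      (integral_pos_of_isTestFunction (.fkIter hg (.const 1) _ _) (fun y => ih _ y) (f x))

/-- The filter flow is the normalized semigroup. -/
lemma integral_flow {g : ℕ → X → ℝ} (hg : ∀ n, IsTestFunction (g n)) (hpos : ∀ n x, 0 < g n x)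
    {φ : X → ℝ} (hφ : IsTestFunction φ) (k j : ℕ) (μ : Measure X) [IsProbabilityMeasure μ] :
    ∫ x, φ x ∂(flow f g k j μ) =
      (∫ x, fkIter f g φ k j x ∂μ) / ∫ x, fkIter f g (fun _ => 1) k j x ∂μ := by
  induction j generalizing k μ with
  | zero => simp [flow, fkIter]
  | succ j ih =>
    have := isProbabilityMeasure_filterStep (f := f) (hg k) (hpos k) μ
    have hp := integral_pos_of_isTestFunction (hg k) (hpos k) μ
    rw [flow, ih, integral_filterStep (hg k) (hpos k) (.fkIter hg hφ _ _),
      integral_filterStep (hg k) (hpos k) (.fkIter hg (.const 1) _ _),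
      div_div_div_cancel_right₀ hp.ne']
    rfl

/-! ### Contraction and stability of the filter flow -/

/-- Domination of the transition kernel carries over to integrals of nonnegative functions. -/
lemma integral_le_of_le_smul {ε : ℝ} (hε : 0 ≤ ε)
    {μ ν : Measure X} [IsProbabilityMeasure μ] [IsProbabilityMeasure ν]
    (h : μ ≤ ENNReal.ofReal ε • ν) {φ : X → ℝ} (hφ : IsTestFunction φ) (h0 : ∀ x, 0 ≤ φ x) :
    ∫ x, φ x ∂μ ≤ ε * ∫ x, φ x ∂ν := by
  have : IsFiniteMeasure (ENNReal.ofReal ε • ν) := ν.smul_finite ENNReal.ofReal_ne_top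
  have := integral_mono_measure h (.of_forall h0) (hφ.integrable _)
  rwa [integral_smul_measure, ENNReal.toReal_ofReal hε] at this

/-- The potentials `Q_k ⋯ Q_{k+j-1} 1` have a ratio bound that does not depend on the horizon,
since each transition forgets its starting point up to the factor `ε`. -/
lemma fkIter_one_le {g : ℕ → X → ℝ} (hg : ∀ n, IsTestFunction (g n)) (hpos : ∀ n x, 0 < g n x)
    {δ ε : ℝ} (hδ : 1 ≤ δ) (hε : 1 ≤ ε) (hgδ : ∀ n x y, g n x ≤ δ * g n y)
    (hf : ∀ x y, f x ≤ ENNReal.ofReal ε • f y) (k j : ℕ) (x y : X) :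
    fkIter f g (fun _ => 1) k j x ≤ δ * ε * fkIter f g (fun _ => 1) k j y := by
  cases j with
  | zero => simpa [fkIter] using one_le_mul_of_one_le_of_one_le hδ hε
  | succ j =>
    have hH : IsTestFunction (fkIter f g (fun _ => 1) (k + 1) j) := .fkIter hg (.const 1) _ _
    have hH0 := fkIter_one_pos (f := f) hg hpos (k + 1) j
    have h1 := integral_le_of_le_smul (by linarith) (hf x y) hH (fun z => (hH0 z).le)
    calc _ ≤ (δ * g k y) * (ε * ∫ z, fkIter f g (fun _ => 1) (k + 1) j z ∂(f y)) :=
          mul_le_mul (hgδ k x y) h1 (integral_nonneg fun z => (hH0 z).le)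
            (mul_nonneg (by linarith) (hpos k y).le)
      _ = _ := by simp only [fkIter, fkStep]; ring

/-- Contraction of oscillations: the normalized semigroup `Q_k ⋯ Q_{k+j-1} φ / Q_k ⋯ Q_{k+j-1} 1`
takes its values in an interval whose length decays geometrically in `j`. Each step shrinks the
interval by the factor `1 - ε⁻²`, as any two of the Markov kernels
`H(y) f(x, dy) / ∫ H(y) f(x, dy)` dominate each other up to the factor `ε²`. -/
lemma exists_fkIter_mem_Icc [Nonempty X] {g : ℕ → X → ℝ} (hg : ∀ n, IsTestFunction (g n))
    (hpos : ∀ n x, 0 < g n x) {ε : ℝ} (hε : 1 ≤ ε)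
    (hf : ∀ x y, f x ≤ ENNReal.ofReal ε • f y) {φ : X → ℝ} (hφ : IsTestFunction φ) {b r : ℝ}
    (hφr : ∀ x, φ x ∈ Set.Icc b (b + r)) (k j : ℕ) :
    ∃ a : ℝ, ∀ x, a * fkIter f g (fun _ => 1) k j x ≤ fkIter f g φ k j x ∧
      fkIter f g φ k j x ≤ (a + (1 - (ε ^ 2)⁻¹) ^ j * r) * fkIter f g (fun _ => 1) k j x := by
  induction j generalizing k with
  | zero => exact ⟨b, fun x => by simpa [fkIter] using hφr x⟩
  | succ j ih =>
    obtain ⟨a, ha⟩ := ih (k + 1)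
    set R := (1 - (ε ^ 2)⁻¹) ^ j * r with hR
    set H := fkIter f g (fun _ => 1) (k + 1) j with hHdef
    set ψ := fkIter f g φ (k + 1) j with hψdef
    have hH : IsTestFunction H := .fkIter hg (.const 1) _ _
    have hψ : IsTestFunction ψ := .fkIter hg hφ _ _
    have hH0 := fkIter_one_pos (f := f) hg hpos (k + 1) j
    obtain ⟨x₀⟩ := ‹Nonempty X›
    have hε0 : 0 < ε := by linarith
    set h := fun x => ∫ z, H z ∂(f x) with hh
    set u := fun x => ∫ z, ψ z ∂(f x) with hu
    have hpos' : ∀ x, 0 < h x := fun x => integral_pos_of_isTestFunction hH hH0 (f x)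
    have int_low : ∀ x, ∫ z, (ψ z - a * H z) ∂(f x) = u x - a * h x := fun x => by
      rw [integral_sub (hψ.integrable _) ((hH.integrable _).const_mul _), integral_const_mul]
    have int_upp : ∀ x, ∫ z, ((a + R) * H z - ψ z) ∂(f x) = (a + R) * h x - u x := fun x => by
      rw [integral_sub ((hH.integrable _).const_mul _) (hψ.integrable _), integral_const_mul]
    have tl : IsTestFunction fun z => ψ z - a * H z := hψ.sub ((IsTestFunction.const a).mul hH)
    have tu : IsTestFunction fun z => (a + R) * H z - ψ z :=
      ((IsTestFunction.const (a + R)).mul hH).sub hψ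
    have hl0 : ∀ z, 0 ≤ ψ z - a * H z := fun z => sub_nonneg.2 (ha z).1
    have hu0 : ∀ z, 0 ≤ (a + R) * H z - ψ z := fun z => sub_nonneg.2 (ha z).2
    set c := u x₀ / h x₀ - a with hc
    have hc0 : 0 ≤ c := by
      have := integral_nonneg (μ := f x₀) (f := fun z => ψ z - a * H z) hl0
      rw [int_low] at this
      rw [hc, sub_nonneg, le_div_iff₀ (hpos' _)]
      linarith
    have hcR : c ≤ R := by
      have := integral_nonneg (μ := f x₀) (f := fun z => (a + R) * H z - ψ z) hu0
      rw [int_upp] at this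
      rw [hc, sub_le_iff_le_add, div_le_iff₀ (hpos' _)]
      linarith
    -- With the minorization by `ε⁻²` of the values at `x₀`, the values of the new ratio `u / h` lie
    -- at least `ε⁻² c` above `a` and at least `ε⁻² (R - c)` below `a + R`.
    have key : ∀ x, (ε ^ 2)⁻¹ * c * h x ≤ u x - a * h x ∧
        (ε ^ 2)⁻¹ * (R - c) * h x ≤ (a + R) * h x - u x := fun x => by
      have e1 := integral_le_of_le_smul hε0.le (hf x₀ x) tl hl0
      have e2 := integral_le_of_le_smul hε0.le (hf x₀ x) tu hu0
      have e3 := integral_le_of_le_smul hε0.le (hf x x₀) hH (fun z => (hH0 z).le)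
      rw [int_low, int_low] at e1
      rw [int_upp, int_upp] at e2
      have e4 : u x₀ = (c + a) * h x₀ := by
        rw [hc]; field_simp [(hpos' x₀).ne']; ring
      change h x ≤ ε * h x₀ at e3
      constructor
      · rw [mul_assoc, inv_mul_le_iff₀ (by positivity)]
        have := mul_le_mul_of_nonneg_left e3 hc0
        have := mul_le_mul_of_nonneg_left e1 hε0.le
        rw [e4] at this
        nlinarith
      · rw [mul_assoc, inv_mul_le_iff₀ (by positivity)]
        have := mul_le_mul_of_nonneg_left e3 (sub_nonneg.2 hcR)
        have := mul_le_mul_of_nonneg_left e2 hε0.le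
        rw [e4] at this
        nlinarith
    refine ⟨a + (ε ^ 2)⁻¹ * c, fun x => ?_⟩
    obtain ⟨k1, k2⟩ := key x
    have hgx := (hpos k x).le
    have E1 : fkIter f g (fun _ => 1) k (j + 1) x = g k x * h x := rfl
    have E2 : fkIter f g φ k (j + 1) x = g k x * u x := rfl
    rw [E1, E2]
    constructor
    · have : (a + (ε ^ 2)⁻¹ * c) * h x ≤ u x := by linarith
      nlinarith
    · have : u x ≤ (a + (ε ^ 2)⁻¹ * c + (1 - (ε ^ 2)⁻¹) * R) * h x := by linarith
      have := mul_le_mul_of_nonneg_left this hgx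
      rw [pow_succ]
      calc _ ≤ _ := this
        _ = _ := by rw [hR]; ring

/-- Difference of two ratios in terms of the differences of numerators and denominators. -/
lemma abs_div_sub_div_le {x₁ x₂ y₁ y₂ K : ℝ} (hK : 0 < K) (hx : K⁻¹ ≤ x₂) (hy : 0 < y₂)
    (hy' : |y₁| ≤ y₂) : |x₁ / x₂ - y₁ / y₂| ≤ K * (|x₁ - y₁| + |x₂ - y₂|) := by
  have hx0 : 0 < x₂ := (inv_pos.2 hK).trans_le hx
  have e : x₁ / x₂ - y₁ / y₂ = x₂⁻¹ * ((x₁ - y₁) - y₁ / y₂ * (x₂ - y₂)) := by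
    field_simp; ring
  have h1 : |y₁ / y₂| ≤ 1 := by rw [abs_div, abs_of_pos hy]; exact (div_le_one hy).2 hy'
  rw [e, abs_mul, abs_of_pos (inv_pos.2 hx0)]
  refine mul_le_mul (inv_le_of_inv_le₀ hK hx) ?_ (abs_nonneg _) hK.le
  refine (abs_sub _ _).trans (add_le_add le_rfl ?_)
  rw [abs_mul]
  exact mul_le_of_le_one_left (abs_nonneg _) h1

/-- Exponential stability of the filter flow in weak form: two test functions `h₁`, `h₂`, which do
not depend on the initial measures, control the distance of the flows from two initial measures.
That `h₁` and `h₂` are the same for all `μ` and `ν` allows for random `μ` and `ν`. -/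
lemma exists_abs_integral_flow_sub_le [Nonempty X] {g : ℕ → X → ℝ}
    (hg : ∀ n, IsTestFunction (g n)) (hpos : ∀ n x, 0 < g n x) {δ ε : ℝ} (hδ : 1 ≤ δ) (hε : 1 < ε)
    (hgδ : ∀ n x y, g n x ≤ δ * g n y) (hf : ∀ x y, f x ≤ ENNReal.ofReal ε • f y)
    {φ : X → ℝ} (hφ : IsTestFunction φ) {b r : ℝ} (hr : 0 < r)
    (hφr : ∀ x, φ x ∈ Set.Icc b (b + r)) (k j : ℕ) :
    ∃ h₁ h₂ : X → ℝ, Measurable h₁ ∧ (∀ x, |h₁ x| ≤ 1) ∧ Measurable h₂ ∧ (∀ x, |h₂ x| ≤ 1) ∧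
      ∀ (μ ν : Measure X) [IsProbabilityMeasure μ] [IsProbabilityMeasure ν],
        |∫ x, φ x ∂(flow f g k j μ) - ∫ x, φ x ∂(flow f g k j ν)| ≤
          ((δ * ε) ^ 2 * r) * (1 - (ε ^ 2)⁻¹) ^ j *
            (|∫ x, h₁ x ∂μ - ∫ x, h₁ x ∂ν| + |∫ x, h₂ x ∂μ - ∫ x, h₂ x ∂ν|) := by
  obtain ⟨a, ha⟩ := exists_fkIter_mem_Icc (f := f) hg hpos hε.le hf hφ hφr k j
  set R := (1 - (ε ^ 2)⁻¹) ^ j * r with hR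
  set H := fkIter f g (fun _ => 1) k j with hHdef
  set ψ := fkIter f g φ k j with hψdef
  have hH : IsTestFunction H := .fkIter hg (.const 1) _ _
  have hψ : IsTestFunction ψ := .fkIter hg hφ _ _
  have hH0 : ∀ x, 0 < H x := fkIter_one_pos (f := f) hg hpos k j
  have hHK : ∀ x y, H x ≤ δ * ε * H y := fkIter_one_le hg hpos hδ hε.le hgδ hf k j
  have hε0 : 0 < ε := by linarith
  have hδ0 : 0 < δ := by linarith
  have hR0 : 0 < R := mul_pos (pow_pos (sub_pos.2 (inv_lt_one_of_one_lt₀ (by nlinarith))) _) hr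
  obtain ⟨x₀⟩ := ‹Nonempty X›
  -- Division by `D` puts `H` into `[(δ ε)⁻², 1]`, by the ratio bound.
  set D := δ * ε * H x₀ with hD
  have hD0 : 0 < D := mul_pos (mul_pos hδ0 hε0) (hH0 _)
  have hHD : ∀ x, H x ≤ D := fun x => hHK x x₀
  have b1 : ∀ x, |(ψ x - a * H x) / (D * R)| ≤ H x / D := fun x => by
    have := ha x
    rw [abs_of_nonneg (div_nonneg (by linarith) (by positivity)), div_le_div_iff₀ (by positivity)
      hD0]
    have : ψ x - a * H x ≤ R * H x := by linarith
    nlinarith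
  have b2 : ∀ x, H x / D ≤ 1 := fun x => (div_le_one hD0).2 (hHD x)
  have b3 : ∀ x, ((δ * ε) ^ 2)⁻¹ ≤ H x / D := fun x => by
    rw [le_div_iff₀ hD0, inv_mul_le_iff₀ (by positivity), hD]
    nlinarith [mul_le_mul_of_nonneg_left (hHK x₀ x) (mul_pos hδ0 hε0).le]
  have t1 : IsTestFunction fun x => (ψ x - a * H x) / (D * R) := by
    simpa only [div_eq_mul_inv] using
      (hψ.sub ((IsTestFunction.const a).mul hH)).mul (.const (D * R)⁻¹)
  have t2 : IsTestFunction fun x => H x / D := by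
    simpa only [div_eq_mul_inv] using hH.mul (.const D⁻¹)
  refine ⟨fun x => (ψ x - a * H x) / (D * R), fun x => H x / D, t1.measurable,
    fun x => (b1 x).trans (b2 x), t2.measurable, fun x => ?_, ?_⟩
  · rw [abs_of_pos (div_pos (hH0 x) hD0)]; exact b2 x
  intro μ ν _ _
  have rep : ∀ (κ : Measure X) [IsProbabilityMeasure κ], ∫ x, φ x ∂(flow f g k j κ) =
      a + R * ((∫ x, (ψ x - a * H x) / (D * R) ∂κ) / ∫ x, H x / D ∂κ) := fun κ _ => by
    have := (integral_pos_of_isTestFunction hH hH0 κ).ne'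
    rw [integral_flow hg hpos hφ]
    change (∫ x, ψ x ∂κ) / (∫ x, H x ∂κ) = _
    rw [integral_div, integral_div, integral_sub (hψ.integrable _)
      ((hH.integrable _).const_mul _), integral_const_mul]
    field_simp
    ring
  rw [rep μ, rep ν, add_sub_add_left_eq_sub, ← mul_sub, abs_mul, abs_of_pos hR0]
  have := abs_div_sub_div_le (x₁ := ∫ x, (ψ x - a * H x) / (D * R) ∂μ) (x₂ := ∫ x, H x / D ∂μ)
    (y₁ := ∫ x, (ψ x - a * H x) / (D * R) ∂ν) (y₂ := ∫ x, H x / D ∂ν)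
    (K := (δ * ε) ^ 2) (by positivity) ?_
    (integral_pos_of_isTestFunction t2 (fun x => div_pos (hH0 x) hD0) ν) ?_
  · calc _ ≤ R * _ := mul_le_mul_of_nonneg_left this hR0.le
      _ = _ := by rw [hR]; ring
  · simpa using integral_mono (μ := μ) (integrable_const (((δ * ε) ^ 2)⁻¹)) (t2.integrable μ) b3
  · exact (abs_integral_le_integral_abs).trans (integral_mono (t1.integrable ν).abs
      (t2.integrable ν) b1)

end

section

variable {X : Type*} [MeasurableSpace X]

/-! ### Moments of weighted sums of independent variables -/

/-- A bound for the `p`-th absolute moment of a sub-Gaussian variable `Y` with variance proxy `1`: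
`⌈p⌉!` comes from `|t| ^ p ≤ ⌈p⌉! (exp t + exp (-t))`, and `2 exp (1 / 2)` bounds
`𝔼[exp Y + exp (-Y)]`. -/
noncomputable def momentBound (p : ℝ) : ℝ := (⌈p⌉₊.factorial : ℝ) * (2 * Real.exp (1 / 2))

lemma abs_rpow_le_factorial_mul_exp {p : ℝ} (hp : 0 ≤ p) (t : ℝ) :
    |t| ^ p ≤ (⌈p⌉₊.factorial : ℝ) * (Real.exp t + Real.exp (-t)) := by
  have hfac : (1 : ℝ) ≤ (⌈p⌉₊.factorial : ℝ) := by exact_mod_cast Nat.factorial_pos _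
  have h1 : |t| ^ p ≤ (⌈p⌉₊.factorial : ℝ) * Real.exp |t| := by
    rcases le_total |t| 1 with h | h
    · have := Real.one_le_exp (abs_nonneg t)
      calc |t| ^ p ≤ 1 := Real.rpow_le_one (abs_nonneg t) h hp
        _ ≤ _ := one_le_mul_of_one_le_of_one_le hfac this
    · calc |t| ^ p ≤ |t| ^ (⌈p⌉₊ : ℝ) := Real.rpow_le_rpow_of_exponent_le h (Nat.le_ceil p)
        _ = |t| ^ ⌈p⌉₊ := Real.rpow_natCast _ _
        _ ≤ _ := by
          have := Real.pow_div_factorial_le_exp |t| (abs_nonneg t) ⌈p⌉₊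
          rwa [div_le_iff₀' (by linarith)] at this
  refine h1.trans (mul_le_mul_of_nonneg_left ?_ (by linarith))
  rcases abs_cases t with ⟨h, -⟩ | ⟨h, -⟩ <;> rw [h] <;>
    linarith [Real.exp_pos t, Real.exp_pos (-t)]

/-- A weighted sum of centred independent variables with values in `[-1, 1]` has an `L^p`
norm of order `(∑ wᵢ²) ^ (1 / 2)`: by Hoeffding's lemma the sum is sub-Gaussian with variance proxy
`∑ wᵢ²`. -/
lemma lintegral_pi_rpow_le {ι : Type*} [Fintype ι] (μ : ι → Measure X)
    [∀ i, IsProbabilityMeasure (μ i)] {h : X → ℝ} (hm : Measurable h) (hb : ∀ x, |h x| ≤ 1)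
    (w : ι → ℝ) {s : ℝ} (hs : 0 ≤ s) (hw : s * ∑ i, w i ^ 2 ≤ 1) {p : ℝ} (hp : 0 ≤ p) :
    ∫⁻ x, ENNReal.ofReal (|√s * ∑ i, w i * (h (x i) - ∫ y, h y ∂(μ i))| ^ p) ∂(Measure.pi μ) ≤
      ENNReal.ofReal (momentBound p) := by
  have hsub : ∀ i, HasSubgaussianMGF (fun x : ι → X => w i * (h (x i) - ∫ y, h y ∂(μ i)))
      (‖w i‖₊ ^ 2) (Measure.pi μ) := fun i => by
    have h1 := hasSubgaussianMGF_of_mem_Icc (μ := Measure.pi μ)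
      (X := fun x : ι → X => w i * h (x i)) (a := -|w i|) (b := |w i|)
      ((hm.comp (measurable_pi_apply i)).const_mul _).aemeasurable
      (.of_forall fun x => abs_le.1 <| by
        rw [abs_mul]; exact mul_le_of_le_one_right (abs_nonneg _) (hb _))
    rw [integral_const_mul, integral_comp_eval hm.aestronglyMeasurable] at h1
    simp only [← mul_sub] at h1
    convert h1 using 1
    ext
    simp [← two_mul, sq_abs]
  have hind : iIndepFun (fun i (x : ι → X) => w i * (h (x i) - ∫ y, h y ∂(μ i)))
      (Measure.pi μ) :=
    iIndepFun_pi (X := fun i y => w i * (h y - ∫ y, h y ∂(μ i)))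
      fun i => ((hm.sub_const _).const_mul _).aemeasurable
  have hsum := HasSubgaussianMGF.sum_of_iIndepFun hind (s := Finset.univ) fun i _ => hsub i
  set S := fun x : ι → X => ∑ i, w i * (h (x i) - ∫ y, h y ∂(μ i)) with hS
  have hexp : ∀ t : ℝ, t ^ 2 = s → ∫ x, Real.exp (t * S x) ∂(Measure.pi μ) ≤ Real.exp (1 / 2) :=
    fun t ht => (hsum.mgf_le t).trans <| by
      rw [ht]
      gcongr
      simpa [mul_comm] using hw
  have hsq : √s ^ 2 = s := Real.sq_sqrt hs
  have i1 := hsum.integrable_exp_mul (√s)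
  have i2 := hsum.integrable_exp_mul (-√s)
  -- The moment generating function is needed at `t = √s` and `t = -√s` only.
  calc _ ≤ ∫⁻ x, ENNReal.ofReal ((⌈p⌉₊.factorial : ℝ) *
        (Real.exp (√s * S x) + Real.exp (-√s * S x))) ∂(Measure.pi μ) :=
        lintegral_mono fun x => ENNReal.ofReal_le_ofReal <| by
          rw [neg_mul]; exact abs_rpow_le_factorial_mul_exp hp _
    _ = ENNReal.ofReal (∫ x, (⌈p⌉₊.factorial : ℝ) *
        (Real.exp (√s * S x) + Real.exp (-√s * S x)) ∂(Measure.pi μ)) :=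
        (ofReal_integral_eq_lintegral_ofReal ((i1.add i2).const_mul _)
          (.of_forall fun x => mul_nonneg (Nat.cast_nonneg _)
            (add_nonneg (Real.exp_nonneg _) (Real.exp_nonneg _)))).symm
    _ ≤ _ := by
        refine ENNReal.ofReal_le_ofReal ?_
        rw [integral_const_mul, integral_add i1 i2, momentBound]
        have := hexp (√s) hsq
        have := hexp (-√s) (by rw [neg_sq, hsq])
        gcongr
        linarith

end

section

/-! ### Groups and index maps -/

lemma mem_group {M m : ℕ} {i j : Fin (M * m)} : j ∈ group M m i ↔ (j : ℕ) / M = (i : ℕ) / M := by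
  simp [group]

lemma group_eq_of_mem {M m : ℕ} {i j : Fin (M * m)} (h : j ∈ group M m i) :
    group M m j = group M m i := by
  ext k; rw [mem_group, mem_group, mem_group.1 h]

lemma card_group {M m : ℕ} (i : Fin (M * m)) : (group M m i).card = M := by
  have hM : 0 < M := Nat.pos_of_mul_pos_right i.pos
  have hi : (i : ℕ) / M < m := Nat.div_lt_of_lt_mul i.isLt
  have hle : M * ((i : ℕ) / M) + M ≤ M * m := by
    calc _ = M * ((i : ℕ) / M + 1) := by ring
      _ ≤ _ := Nat.mul_le_mul_left M hi
  have : (group M m i).card = (Finset.Ico (M * ((i : ℕ) / M)) (M * ((i : ℕ) / M) + M)).card := by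
    refine Finset.card_bij (fun j _ => (j : ℕ)) (fun j hj => ?_) (fun _ _ _ _ h => Fin.ext h)
      fun b hb => ?_
    · rw [← mem_group.1 hj, Finset.mem_Ico]
      exact ⟨Nat.mul_div_le _ _, by have := Nat.lt_mul_div_succ (j : ℕ) hM; linarith⟩
    · rw [Finset.mem_Ico] at hb
      refine ⟨⟨b, hb.2.trans_le hle⟩, mem_group.2 ?_, rfl⟩
      exact Nat.div_eq_of_lt_le (by linarith [hb.1]) (by linarith [hb.2])
  rw [this, Nat.card_Ico, Nat.add_sub_cancel_left]

/-- Summation over the groups of all particles counts each particle `M` times. -/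
lemma sum_sum_group {M m : ℕ} (F : Fin (M * m) → ℝ) :
    ∑ i, ∑ j ∈ group M m i, F j = M * ∑ j, F j := by
  have h : ∀ i j : Fin (M * m), i ∈ Finset.univ ∧ j ∈ group M m i ↔
      i ∈ group M m j ∧ j ∈ Finset.univ := fun i j => by
    simp [mem_group, eq_comm]
  rw [Finset.sum_comm' h]
  simp [card_group, Finset.mul_sum]

lemma localExchange_bijective (M m θ : ℕ) : Function.Bijective (localExchange M m θ) := by
  refine Finite.injective_iff_bijective.1 fun i j h => ?_
  have h1 : ((i : ℕ) + θ) ≡ ((j : ℕ) + θ) [MOD M * m] := congrArg Fin.val h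
  exact Fin.ext (Nat.ModEq.eq_of_lt_of_lt (Nat.ModEq.add_right_cancel' θ h1) i.isLt j.isLt)

variable {X : Type*}

/-! ### Weights and the effective sample fraction -/

section Weight

variable {g : ℕ → X → ℝ} {M m : ℕ} {L : Fin (M * m) → Fin (M * m)}

lemma weight_pos (hpos : ∀ n x, 0 < g n x) (z : ℕ → Fin (M * m) → X) (n : ℕ)
    (i : Fin (M * m)) : 0 < weight g M m L z n i := by
  induction n generalizing i with
  | zero => simp [weight]
  | succ n ih =>
    exact mul_pos (inv_pos.2 (Nat.cast_pos.2 i.pos))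
      (Finset.sum_pos (fun j _ => mul_pos (ih _) (hpos _ _)) ⟨i, mem_group.2 rfl⟩)

lemma sum_group_pos (hpos : ∀ n x, 0 < g n x) (z : ℕ → Fin (M * m) → X) (n : ℕ)
    (i : Fin (M * m)) :
    0 < ∑ j ∈ group M m i, weight g M m L z n (L j) * g n (z n (L j)) :=
  Finset.sum_pos (fun _ _ => mul_pos (weight_pos hpos z n _) (hpos _ _)) ⟨i, mem_group.2 rfl⟩

lemma weight_eq_of_mem_group (z : ℕ → Fin (M * m) → X) (n : ℕ) {i j : Fin (M * m)}
    (h : j ∈ group M m i) : weight g M m L z n j = weight g M m L z n i := by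
  cases n with
  | zero => rfl
  | succ n => simp only [weight, group_eq_of_mem h]

/-- The weights are constant on groups, so that no single weight exceeds the fraction `1 / M` of
the total weight. -/
lemma mul_sum_weight_sq_le (hpos : ∀ n x, 0 < g n x) (z : ℕ → Fin (M * m) → X) (n : ℕ) :
    M * ∑ i, weight g M m L z n i ^ 2 ≤ (∑ i, weight g M m L z n i) ^ 2 := by
  rw [sq (∑ i, weight g M m L z n i), Finset.sum_mul, Finset.mul_sum]
  refine Finset.sum_le_sum fun i _ => ?_
  have h1 : M * weight g M m L z n i = ∑ j ∈ group M m i, weight g M m L z n j := by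
    rw [Finset.sum_congr rfl fun _ hj => weight_eq_of_mem_group z n hj]
    simp [card_group]
  calc M * weight g M m L z n i ^ 2
      = weight g M m L z n i * (M * weight g M m L z n i) := by ring
    _ ≤ _ := by
      rw [h1]
      exact mul_le_mul_of_nonneg_left (Finset.sum_le_univ_sum_of_nonneg fun j =>
        (weight_pos hpos z n j).le) (weight_pos hpos z n i).le

lemma weight_congr {z z' : ℕ → Fin (M * m) → X} {n : ℕ} (h : ∀ k < n, z k = z' k) :
    weight g M m L z n = weight g M m L z' n := by
  induction n with
  | zero => rfl
  | succ n ih =>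
    ext i
    simp only [weight, ih fun k hk => h k (by omega), h n (by omega)]

lemma sum_weight_pos (hpos : ∀ n x, 0 < g n x) (hM : 1 ≤ M) (hm : 1 ≤ m)
    (z : ℕ → Fin (M * m) → X) (n : ℕ) : 0 < ∑ i, weight g M m L z n i :=
  Finset.sum_pos (fun i _ => weight_pos hpos z n i) ⟨⟨0, Nat.mul_pos hM hm⟩, Finset.mem_univ _⟩

lemma one_div_le_effectiveFraction (hpos : ∀ n x, 0 < g n x) (hM : 1 ≤ M) (hm : 1 ≤ m)
    (z : ℕ → Fin (M * m) → X) (n : ℕ) : 1 / (m : ℝ) ≤ effectiveFraction g M m L z n := by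
  have h := mul_sum_weight_sq_le (L := L) hpos z n
  have hM' : (0 : ℝ) < M := by exact_mod_cast hM
  have hm' : (0 : ℝ) < m := by exact_mod_cast hm
  have hs : 0 < ∑ i, weight g M m L z n i ^ 2 :=
    Finset.sum_pos (fun i _ => pow_pos (weight_pos hpos z n i) 2)
      ⟨⟨0, Nat.mul_pos hM hm⟩, Finset.mem_univ _⟩
  rw [effectiveFraction, Nat.cast_mul, div_le_div_iff₀ hm' (by positivity)]
  calc 1 * (((M : ℝ) * m)⁻¹ * ∑ i, weight g M m L z n i ^ 2)
      = ((M : ℝ) * m)⁻¹ ^ 2 * m * (M * ∑ i, weight g M m L z n i ^ 2) := by field_simp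
    _ ≤ ((M : ℝ) * m)⁻¹ ^ 2 * m * (∑ i, weight g M m L z n i) ^ 2 := by gcongr
    _ = _ := by ring

end Weight

variable [MeasurableSpace X] {f : Kernel X X} {g : ℕ → X → ℝ} {M m : ℕ}
  {L : Fin (M * m) → Fin (M * m)}

/-! ### Proposals and the weighted empirical measure -/

lemma proposal_congr {z z' : ℕ → Fin (M * m) → X} {n : ℕ} (h : ∀ k ≤ n, z k = z' k) :
    proposal f g M m L z n = proposal f g M m L z' n := by
  ext1 i
  simp only [proposal, weight_congr (fun k hk => h k hk.le), h n le_rfl]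

lemma isProbabilityMeasure_proposal [IsMarkovKernel f]
    (hpos : ∀ n x, 0 < g n x) (z : ℕ → Fin (M * m) → X) (n : ℕ)
    (i : Fin (M * m)) : IsProbabilityMeasure (proposal f g M m L z n i) := by
  have hs := sum_group_pos (L := L) hpos z n i
  constructor
  simp only [proposal, Measure.coe_finsetSum, Finset.sum_apply, Measure.smul_apply, measure_univ,
    smul_eq_mul, mul_one]
  rw [← ENNReal.ofReal_sum_of_nonneg fun j _ =>
    div_nonneg (mul_pos (weight_pos hpos z n _) (hpos _ _)).le hs.le, ← Finset.sum_div,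
    div_self hs.ne', ENNReal.ofReal_one]

lemma integral_proposal [IsMarkovKernel f]
    (hpos : ∀ n x, 0 < g n x) (z : ℕ → Fin (M * m) → X) (n : ℕ)
    (i : Fin (M * m)) {h : X → ℝ} (hh : IsTestFunction h) :
    ∫ x, h x ∂(proposal f g M m L z n i) =
      (∑ j ∈ group M m i, weight g M m L z n (L j) * fkStep f (g n) h (z n (L j))) /
        ∑ j ∈ group M m i, weight g M m L z n (L j) * g n (z n (L j)) := by
  have hs := sum_group_pos (L := L) hpos z n i
  rw [proposal, integral_finsetSum_measure fun j _ =>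
    (hh.integrable _).smul_measure ENNReal.ofReal_ne_top, Finset.sum_div]
  refine Finset.sum_congr rfl fun j _ => ?_
  rw [integral_smul_measure, ENNReal.toReal_ofReal
    (div_nonneg (mul_pos (weight_pos hpos z n _) (hpos _ _)).le hs.le), smul_eq_mul, fkStep]
  ring

/-- The weighted empirical measure `(∑_i W_n^i δ_{z_n^i}) / (∑_i W_n^i)`. -/
noncomputable def empirical (g : ℕ → X → ℝ) (M m : ℕ) (L : Fin (M * m) → Fin (M * m))
    (z : ℕ → Fin (M * m) → X) (n : ℕ) : Measure X :=
  ∑ i, ENNReal.ofReal (weight g M m L z n i / ∑ l, weight g M m L z n l) •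
    Measure.dirac (z n i)

lemma isProbabilityMeasure_empirical (hpos : ∀ n x, 0 < g n x) (hM : 1 ≤ M) (hm : 1 ≤ m)
    (z : ℕ → Fin (M * m) → X) (n : ℕ) : IsProbabilityMeasure (empirical g M m L z n) := by
  have hs := sum_weight_pos (L := L) hpos hM hm z n
  constructor
  simp only [empirical, Measure.coe_finsetSum, Finset.sum_apply, Measure.smul_apply, measure_univ,
    smul_eq_mul, mul_one]
  rw [← ENNReal.ofReal_sum_of_nonneg fun j _ => div_nonneg (weight_pos hpos z n _).le hs.le,
    ← Finset.sum_div, div_self hs.ne', ENNReal.ofReal_one]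

lemma integral_empirical (hpos : ∀ n x, 0 < g n x) (hM : 1 ≤ M) (hm : 1 ≤ m)
    (z : ℕ → Fin (M * m) → X) (n : ℕ) {h : X → ℝ} (hh : IsTestFunction h) :
    ∫ x, h x ∂(empirical g M m L z n) = estimate g M m L z n h := by
  have hs := sum_weight_pos (L := L) hpos hM hm z n
  rw [empirical, integral_finsetSum_measure fun j _ =>
    (hh.integrable _).smul_measure ENNReal.ofReal_ne_top, estimate, Finset.sum_div]
  refine Finset.sum_congr rfl fun j _ => ?_
  rw [integral_smul_measure, ENNReal.toReal_ofReal (div_nonneg (weight_pos hpos z n _).le hs.le),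
    smul_eq_mul, integral_dirac' _ _ hh.measurable.stronglyMeasurable]
  ring

/-- The weighted average of the proposals is the filter step applied to the weighted empirical
measure. The exchange of particles is invisible here because the index map is a bijection. -/
lemma sum_weight_mul_integral_proposal [IsMarkovKernel f]
    (hL : Function.Bijective L) (hg : ∀ n, IsTestFunction (g n))
    (hpos : ∀ n x, 0 < g n x) (hM : 1 ≤ M) (hm : 1 ≤ m) (z : ℕ → Fin (M * m) → X) (n : ℕ)
    {h : X → ℝ} (hh : IsTestFunction h) :
    ∑ i, weight g M m L z (n + 1) i / (∑ l, weight g M m L z (n + 1) l) *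
        ∫ x, h x ∂(proposal f g M m L z n i) =
      ∫ x, h x ∂(filterStep f (g n) (empirical g M m L z n)) := by
  have := isProbabilityMeasure_empirical (L := L) hpos hM hm z n
  have hN : ((M * m : ℕ) : ℝ)⁻¹ * M ≠ 0 := by
    have : (M : ℝ) ≠ 0 := by exact_mod_cast (by omega : M ≠ 0)
    have : (m : ℝ) ≠ 0 := by exact_mod_cast (by omega : m ≠ 0)
    push_cast
    positivity
  have tot : ∀ F : X → ℝ, ∑ i, ((M * m : ℕ) : ℝ)⁻¹ * ∑ j ∈ group M m i,
      weight g M m L z n (L j) * F (z n (L j)) =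
        ((M * m : ℕ) : ℝ)⁻¹ * M * ∑ i, weight g M m L z n i * F (z n i) := fun F => by
    rw [← Finset.mul_sum, sum_sum_group, mul_assoc,
      hL.sum_comp fun i => weight g M m L z n i * F (z n i)]
  have key : ∀ i, weight g M m L z (n + 1) i * ∫ x, h x ∂(proposal f g M m L z n i) =
      ((M * m : ℕ) : ℝ)⁻¹ * ∑ j ∈ group M m i,
        weight g M m L z n (L j) * fkStep f (g n) h (z n (L j)) := fun i => by
    have hs := (sum_group_pos (L := L) hpos z n i).ne'
    rw [integral_proposal hpos z n i hh, weight, mul_assoc, mul_div_cancel₀ _ hs]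
  rw [integral_filterStep (hg n) (hpos n) hh, integral_empirical hpos hM hm z n ((hg n).fkStep hh),
    integral_empirical hpos hM hm z n (hg n), estimate, estimate,
    div_div_div_cancel_right₀ (sum_weight_pos hpos hM hm z n).ne']
  simp only [div_mul_eq_mul_div, key]
  have hden : ∑ i, weight g M m L z (n + 1) i =
      ((M * m : ℕ) : ℝ)⁻¹ * M * ∑ i, weight g M m L z n i * g n (z n i) := tot (g n)
  rw [← Finset.sum_div, tot, hden, mul_div_mul_left _ _ hN]

/-! ### Measurability in the particle path and the transition kernel -/

lemma measurable_weight (hg : ∀ n, Measurable (g n)) (n : ℕ) (i : Fin (M * m)) :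
    Measurable fun z : ℕ → Fin (M * m) → X => weight g M m L z n i := by
  induction n generalizing i with
  | zero => exact measurable_const
  | succ n ih =>
    simp only [weight]
    refine (Finset.measurable_sum _ fun j _ => (ih _).mul ((hg n).comp ?_)).const_mul _
    exact (measurable_pi_apply (L j)).comp (measurable_pi_apply n)

lemma measurable_estimate (hg : ∀ n, Measurable (g n)) (n : ℕ) {h : X → ℝ} (hh : Measurable h) :
    Measurable fun z : ℕ → Fin (M * m) → X => estimate g M m L z n h :=
  (Finset.measurable_sum _ fun i _ => (measurable_weight hg n i).mul
    (hh.comp ((measurable_pi_apply i).comp (measurable_pi_apply n)))).div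
    (Finset.measurable_sum _ fun i _ => measurable_weight hg n i)

lemma measurable_sum_group (hg : ∀ n, Measurable (g n)) (n : ℕ) (i : Fin (M * m)) {h : X → ℝ}
    (hh : Measurable h) : Measurable fun z : ℕ → Fin (M * m) → X =>
      ∑ j ∈ group M m i, weight g M m L z n (L j) * h (z n (L j)) :=
  Finset.measurable_sum _ fun j _ => (measurable_weight hg n _).mul
    (hh.comp ((measurable_pi_apply (L j)).comp (measurable_pi_apply n)))

lemma measurable_integral_proposal [IsMarkovKernel f]
    (hg : ∀ n, IsTestFunction (g n)) (hpos : ∀ n x, 0 < g n x)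
    (n : ℕ) (i : Fin (M * m)) {h : X → ℝ} (hh : IsTestFunction h) :
    Measurable fun z : ℕ → Fin (M * m) → X => ∫ x, h x ∂(proposal f g M m L z n i) := by
  simp only [integral_proposal hpos _ n i hh]
  exact (measurable_sum_group (fun n => (hg n).measurable) n i ((hg n).fkStep hh).measurable).div
    (measurable_sum_group (fun n => (hg n).measurable) n i (hg n).measurable)

lemma measurable_proposal (hg : ∀ n, Measurable (g n)) (n : ℕ) (i : Fin (M * m)) :
    Measurable fun z : ℕ → Fin (M * m) → X => proposal f g M m L z n i := by
  refine Measure.measurable_of_measurable_coe _ fun A hA => ?_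
  simp only [proposal, Measure.coe_finsetSum, Finset.sum_apply, Measure.smul_apply, smul_eq_mul]
  refine Finset.measurable_sum _ fun j _ => ?_
  have hz : Measurable fun z : ℕ → Fin (M * m) → X => z n (L j) :=
    (measurable_pi_apply (L j)).comp (measurable_pi_apply n)
  exact (((measurable_weight hg n _).mul ((hg n).comp hz)).div
    (measurable_sum_group hg n i (hg n))).ennreal_ofReal.mul
      ((f.measurable_coe hA).comp hz)

/-- The transition kernel of the particle system: given the path `z` up to time `n`, the particles
at time `n + 1` are independent and follow their proposals. -/
noncomputable def transition (f : Kernel X X) [IsMarkovKernel f] (hg : ∀ n, Measurable (g n))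
    (hpos : ∀ n x, 0 < g n x) (L : Fin (M * m) → Fin (M * m)) (n : ℕ) :
    Kernel (ℕ → Fin (M * m) → X) (Fin (M * m) → X) where
  toFun z := Measure.pi (proposal f g M m L z n)
  measurable' := by
    have : ∀ z i, IsProbabilityMeasure (proposal f g M m L z n i) :=
      fun z i => isProbabilityMeasure_proposal hpos z n i
    refine Measurable.measure_of_isPiSystem_of_isProbabilityMeasure generateFrom_pi.symm
      isPiSystem_pi ?_
    rintro _ ⟨A, hA, rfl⟩
    simp only [Measure.pi_pi]
    exact Finset.measurable_prod _ fun i _ =>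
      (Measure.measurable_coe (hA i (Set.mem_univ _))).comp (measurable_proposal hg n i)

instance [IsMarkovKernel f] (hg : ∀ n, Measurable (g n)) (hpos : ∀ n x, 0 < g n x) (n : ℕ) :
    IsMarkovKernel (transition f hg hpos L n) := by
  refine ⟨fun z => ?_⟩
  have : ∀ i, IsProbabilityMeasure (proposal f g M m L z n i) :=
    fun i => isProbabilityMeasure_proposal hpos z n i
  change IsProbabilityMeasure (Measure.pi (proposal f g M m L z n))
  infer_instance

end

section

variable {X : Type*} [MeasurableSpace X] {f : Kernel X X} {g : ℕ → X → ℝ}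
  {M m : ℕ} {L : Fin (M * m) → Fin (M * m)} {π₀ : Measure X}
  {Ω : Type*} {ζ : ℕ → Fin (M * m) → Ω → X}

/-! ### The joint law of successive generations and the sampling error -/

/-- The particle path stopped at time `n`. It carries the information about the particles up to
time `n`. -/
def stoppedPath (ζ : ℕ → Fin (M * m) → Ω → X) (n : ℕ) (ω : Ω) : ℕ → Fin (M * m) → X :=
  fun k i => ζ (min k n) i ω

/-- The σ-algebra generated by the particles up to time `n`. -/
abbrev pastSigma (ζ : ℕ → Fin (M * m) → Ω → X) (n : ℕ) : MeasurableSpace Ω :=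
  ⨆ k ≤ n, ⨆ i, MeasurableSpace.comap (ζ k i) inferInstance

lemma measurable_stoppedPath {mΩ : MeasurableSpace Ω} {n : ℕ}
    (h : ∀ k ≤ n, ∀ i, Measurable (ζ k i)) : Measurable (stoppedPath ζ n) :=
  measurable_pi_lambda _ fun k => measurable_pi_lambda _ fun i => h _ (min_le_right k n) i

lemma measurable_pastSigma_stoppedPath (n : ℕ) :
    Measurable[pastSigma ζ n] (stoppedPath ζ n) :=
  measurable_stoppedPath (mΩ := pastSigma ζ n) fun k hk i =>
    Measurable.mono (comap_measurable (ζ k i))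
      (le_iSup₂_of_le (f := fun k (_ : k ≤ n) => ⨆ i, MeasurableSpace.comap (ζ k i) inferInstance)
        k hk (le_iSup (fun i => MeasurableSpace.comap (ζ k i) inferInstance) i)) le_rfl

namespace IsGroupedFilter

variable [MeasurableSpace Ω] {P : Measure Ω}

/-- The joint law of the particles up to time `n` and those at time `n + 1` is the composition
product of the law of the past with the transition kernel. -/
lemma map_stoppedPath_prodMk [IsMarkovKernel f] [IsProbabilityMeasure P]
    (h : IsGroupedFilter π₀ f g M m L P ζ) (hg : ∀ n, Measurable (g n))
    (hpos : ∀ n x, 0 < g n x) (n : ℕ) :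
    P.map (fun ω => (stoppedPath ζ n ω, fun i => ζ (n + 1) i ω)) =
      (P.map (stoppedPath ζ n)) ⊗ₘ transition f hg hpos L n := by
  have hFle : pastSigma ζ n ≤ ‹MeasurableSpace Ω› :=
    iSup₂_le fun k _ => iSup_le fun i => (h.measurable k i).comap_le
  have hYF := measurable_pastSigma_stoppedPath (ζ := ζ) n
  have hY : Measurable (stoppedPath ζ n) := measurable_stoppedPath fun k _ i => h.measurable k i
  have hZ : Measurable fun ω i => ζ (n + 1) i ω :=
    measurable_pi_lambda _ fun i => h.measurable (n + 1) i
  have := Measure.isProbabilityMeasure_map hY.aemeasurable (μ := P)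
  have := Measure.isProbabilityMeasure_map (hY.prodMk hZ).aemeasurable (μ := P)
  refine ext_of_generate_finite
    (Set.image2 (· ×ˢ ·) {s | MeasurableSet s} (Set.univ.pi '' Set.univ.pi fun _ =>
      {A : Set X | MeasurableSet A}))
    (generateFrom_eq_prod MeasurableSpace.generateFrom_measurableSet generateFrom_pi
      isCountablySpanning_measurableSet
      (IsCountablySpanning.pi fun _ => isCountablySpanning_measurableSet)).symm
    (MeasurableSpace.isPiSystem_measurableSet.prod isPiSystem_pi) ?_ (by simp)
  rintro _ ⟨S, hS, _, ⟨A, hA, rfl⟩, rfl⟩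
  replace hA : ∀ i, MeasurableSet (A i) := fun i => hA i (Set.mem_univ _)
  replace hS : MeasurableSet S := hS
  set E : Set Ω := {ω | ∀ i, ζ (n + 1) i ω ∈ A i} with hE
  have hEm : MeasurableSet E := by
    have : E = (fun ω i => ζ (n + 1) i ω) ⁻¹' Set.univ.pi A := by ext; simp [E]
    rw [this]
    exact hZ (.univ_pi hA)
  have hprop : ∀ ω i, (proposal f g M m L (fun k j => ζ k j ω) n i).real (A i) =
      (proposal f g M m L (stoppedPath ζ n ω) n i).real (A i) := fun ω i => by
    rw [proposal_congr (z' := stoppedPath ζ n ω) fun k hk => by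
      ext i; simp [stoppedPath, min_eq_left hk]]
  have htr : ∀ z, (transition f hg hpos L n z).real (Set.univ.pi A) =
      ∏ i, (proposal f g M m L z n i).real (A i) := fun z => by
    have : ∀ i, IsProbabilityMeasure (proposal f g M m L z n i) :=
      fun i => isProbabilityMeasure_proposal hpos z n i
    change (Measure.pi (proposal f g M m L z n)).real _ = _
    simp [Measure.real, Measure.pi_pi, ENNReal.toReal_prod]
  -- The defining property of the conditional probability, tested on the past event `S`.
  have hcond : ∫ ω in stoppedPath ζ n ⁻¹' S, Set.indicator E (fun _ => (1 : ℝ)) ω ∂P =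
      ∫ ω in stoppedPath ζ n ⁻¹' S,
        (transition f hg hpos L n (stoppedPath ζ n ω)).real (Set.univ.pi A) ∂P := by
    rw [← setIntegral_condExp hFle ((integrable_const 1).indicator hEm) (hYF hS)]
    refine integral_congr_ae (ae_restrict_of_ae ?_)
    filter_upwards [h.step n A hA] with ω hω
    refine hω.trans ?_
    rw [htr]
    simp only [hprop]
  have hmeas : Measurable fun z => transition f hg hpos L n z (Set.univ.pi A) :=
    (transition f hg hpos L n).measurable_coe (.univ_pi hA)
  rw [Measure.map_apply (hY.prodMk hZ) (hS.prod (.univ_pi hA)),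
    Measure.compProd_apply_prod hS (.univ_pi hA), setLIntegral_map hS hmeas hY]
  have hpre : (fun ω => (stoppedPath ζ n ω, fun i => ζ (n + 1) i ω)) ⁻¹' S ×ˢ Set.univ.pi A =
      stoppedPath ζ n ⁻¹' S ∩ E := by ext; simp [E]
  rw [integral_indicator hEm, setIntegral_const, smul_eq_mul, mul_one,
    measureReal_restrict_apply hEm, Set.inter_comm] at hcond
  have hint : Integrable (fun ω => (transition f hg hpos L n (stoppedPath ζ n ω)).real
      (Set.univ.pi A)) (P.restrict (stoppedPath ζ n ⁻¹' S)) :=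
    Integrable.of_bound (hmeas.comp hY).ennreal_toReal.aestronglyMeasurable 1
      (.of_forall fun ω =>
        (Real.norm_of_nonneg measureReal_nonneg).trans_le measureReal_le_one)
  rw [hpre, ← ofReal_measureReal, hcond, ofReal_integral_eq_lintegral_ofReal hint
    (.of_forall fun ω => measureReal_nonneg)]
  refine lintegral_congr fun ω => ?_
  rw [ofReal_measureReal]

/-- One step of sampling: the empirical measure at time `n + 1` differs from the filter step of the
empirical measure at time `n` by a weighted sum of conditionally independent centred variables, for
which the effective sample size is at least `M`. -/
lemma lintegral_empirical_succ_le [IsMarkovKernel f] [IsProbabilityMeasure P]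
    (h : IsGroupedFilter π₀ f g M m L P ζ)
    (hL : Function.Bijective L) (hg : ∀ n, IsTestFunction (g n)) (hpos : ∀ n x, 0 < g n x)
    (hM : 1 ≤ M) (hm : 1 ≤ m) {φ : X → ℝ} (hφ : Measurable φ) (hb : ∀ x, |φ x| ≤ 1) {p : ℝ}
    (hp : 0 ≤ p) (n : ℕ) :
    ∫⁻ ω, ENNReal.ofReal (|√(M : ℝ) * (
      ∫ x, φ x ∂(empirical g M m L (fun k i => ζ k i ω) (n + 1)) -
      ∫ x, φ x ∂(filterStep f (g n) (empirical g M m L (fun k i => ζ k i ω) n)))| ^ p) ∂P ≤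
        ENNReal.ofReal (momentBound p) := by
  have hφ' : IsTestFunction φ := ⟨hφ, 1, hb⟩
  have hgm : ∀ n, Measurable (g n) := fun n => (hg n).measurable
  set w : (ℕ → Fin (M * m) → X) → Fin (M * m) → ℝ := fun z i =>
    weight g M m L z (n + 1) i / ∑ l, weight g M m L z (n + 1) l with hw
  set G : (ℕ → Fin (M * m) → X) × (Fin (M * m) → X) → ℝ≥0∞ := fun q =>
    ENNReal.ofReal (|√(M : ℝ) * ∑ i, w q.1 i *
      (φ (q.2 i) - ∫ y, φ y ∂(proposal f g M m L q.1 n i))| ^ p) with hG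
  have hGm : Measurable G := by
    refine (((Finset.measurable_sum _ fun i _ => ?_).const_mul _).abs.pow_const p).ennreal_ofReal
    refine Measurable.mul ?_ (Measurable.sub ?_ ?_)
    · exact ((measurable_weight hgm _ i).div
        (Finset.measurable_sum _ fun l _ => measurable_weight hgm _ l)).comp measurable_fst
    · exact hφ.comp ((measurable_pi_apply i).comp measurable_snd)
    · exact (measurable_integral_proposal hg hpos n i hφ').comp measurable_fst
  have hY : Measurable (stoppedPath ζ n) := measurable_stoppedPath fun k _ i => h.measurable k i
  have hZ : Measurable fun ω i => ζ (n + 1) i ω :=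
    measurable_pi_lambda _ fun i => h.measurable (n + 1) i
  have hsum : ∀ z, M * ∑ i, w z i ^ 2 ≤ 1 := fun z => by
    have hs := sum_weight_pos (L := L) hpos hM hm z (n + 1)
    simp only [hw, div_pow]
    rw [← Finset.sum_div, ← mul_div_assoc, div_le_one (by positivity)]
    exact mul_sum_weight_sq_le hpos z (n + 1)
  have hpast : ∀ ω, ∀ k ≤ n, stoppedPath ζ n ω k = fun i => ζ k i ω := fun ω k hk => by
    ext i; simp [stoppedPath, min_eq_left hk]
  calc _ = ∫⁻ ω, G (stoppedPath ζ n ω, fun i => ζ (n + 1) i ω) ∂P := by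
        refine lintegral_congr fun ω => ?_
        have e1 : w (stoppedPath ζ n ω) = w fun k i => ζ k i ω := by
          simp only [hw, weight_congr (n := n + 1) fun k hk => hpast ω k (by omega)]
        have e2 := proposal_congr (f := f) (g := g) (L := L) (hpast ω)
        simp only [hG, e1, e2, mul_sub, Finset.sum_sub_distrib]
        rw [integral_empirical hpos hM hm _ _ hφ', estimate, ← mul_sub,
          sum_weight_mul_integral_proposal hL hg hpos hM hm _ n hφ', ← mul_sub, Finset.sum_div]
        simp only [hw, div_mul_eq_mul_div]
    _ = ∫⁻ z, ∫⁻ x, G (z, x) ∂(transition f hgm hpos L n z) ∂(P.map (stoppedPath ζ n)) := by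
        rw [← Measure.lintegral_compProd hGm, ← h.map_stoppedPath_prodMk hgm hpos n,
          lintegral_map hGm (hY.prodMk hZ)]
    _ ≤ ∫⁻ _, ENNReal.ofReal (momentBound p) ∂(P.map (stoppedPath ζ n)) := by
        refine lintegral_mono fun z => ?_
        have : ∀ i, IsProbabilityMeasure (proposal f g M m L z n i) :=
          fun i => isProbabilityMeasure_proposal hpos z n i
        exact lintegral_pi_rpow_le (proposal f g M m L z n) hφ hb (w z) (Nat.cast_nonneg M)
          (hsum z) hp
    _ = _ := by
        have := Measure.isProbabilityMeasure_map hY.aemeasurable (μ := P)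
        simp

lemma lintegral_empirical_zero_le [IsProbabilityMeasure π₀]
    (h : IsGroupedFilter π₀ f g M m L P ζ)
    (hpos : ∀ n x, 0 < g n x) (hM : 1 ≤ M) (hm : 1 ≤ m) {φ : X → ℝ} (hφ : Measurable φ)
    (hb : ∀ x, |φ x| ≤ 1) {p : ℝ} (hp : 0 ≤ p) :
    ∫⁻ ω, ENNReal.ofReal (|√(M : ℝ) * (
      ∫ x, φ x ∂(empirical g M m L (fun k i => ζ k i ω) 0) - ∫ x, φ x ∂π₀)| ^ p) ∂P ≤
        ENNReal.ofReal (momentBound p) := by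
  have hφ' : IsTestFunction φ := ⟨hφ, 1, hb⟩
  have hM' : (M : ℝ) ≠ 0 := by exact_mod_cast (by omega : M ≠ 0)
  have hm' : (1 : ℝ) ≤ m := by exact_mod_cast hm
  have hZ : Measurable fun ω i => ζ 0 i ω := measurable_pi_lambda _ fun i => h.measurable 0 i
  have hGm : Measurable fun x : Fin (M * m) → X => ENNReal.ofReal (|√(M : ℝ) *
      ∑ i, ((M * m : ℕ) : ℝ)⁻¹ * (φ (x i) - ∫ y, φ y ∂π₀)| ^ p) :=
    (((Finset.measurable_sum _ fun i _ => ((hφ.comp (measurable_pi_apply i)).sub_const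
      _).const_mul _).const_mul _).abs.pow_const p).ennreal_ofReal
  refine le_trans (le_of_eq ?_) (lintegral_pi_rpow_le (fun _ : Fin (M * m) => π₀) hφ hb
    (fun _ => ((M * m : ℕ) : ℝ)⁻¹) (Nat.cast_nonneg M) ?_ hp)
  · rw [← h.initial, lintegral_map hGm hZ]
    refine lintegral_congr fun ω => ?_
    rw [integral_empirical hpos hM hm _ _ hφ', estimate]
    simp only [weight, one_mul, Finset.sum_const, Finset.card_univ, Fintype.card_fin, nsmul_eq_mul,
      mul_one, ← Finset.mul_sum, Finset.sum_sub_distrib]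
    congr 4
    push_cast
    field_simp
  · rw [Finset.sum_const, Finset.card_univ, Fintype.card_fin, nsmul_eq_mul]
    push_cast
    field_simp
    exact hm'

end IsGroupedFilter

end

section

/-! ### Propagation of the error -/

lemma eLpNorm_le_of_lintegral_rpow_le {Ω : Type*} [MeasurableSpace Ω] {P : Measure Ω} {D : Ω → ℝ}
    {p c : ℝ} (hp : 1 ≤ p) (h : ∫⁻ ω, ENNReal.ofReal (|D ω| ^ p) ∂P ≤ ENNReal.ofReal c) :
    eLpNorm D (ENNReal.ofReal p) P ≤ ENNReal.ofReal c ^ (1 / p) := by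
  have hp0 : 0 < p := by linarith
  rw [eLpNorm_eq_lintegral_rpow_enorm_toReal (by simpa using hp0) ENNReal.ofReal_ne_top,
    ENNReal.toReal_ofReal hp0.le]
  refine ENNReal.rpow_le_rpow (le_trans (le_of_eq (lintegral_congr fun ω => ?_)) h) (by positivity)
  rw [← ENNReal.ofReal_rpow_of_nonneg (abs_nonneg _) hp0.le, ← Real.norm_eq_abs, ofReal_norm]

variable {X : Type*} [MeasurableSpace X] {f : Kernel X X} {g : ℕ → X → ℝ}

/-- Stability of the filter flow for random initial measures: if they are close in `L^p` when
integrated against single test functions, then so are the flows, with exponential decay. -/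
lemma eLpNorm_integral_flow_sub_le [IsMarkovKernel f] [Nonempty X]
    (hg : ∀ n, IsTestFunction (g n)) (hpos : ∀ n x, 0 < g n x) {δ ε : ℝ} (hδ : 1 ≤ δ) (hε : 1 < ε)
    (hgδ : ∀ n x y, g n x ≤ δ * g n y) (hf : ∀ x y, f x ≤ ENNReal.ofReal ε • f y)
    {φ : X → ℝ} (hφ : IsTestFunction φ) {b r : ℝ} (hr : 0 < r)
    (hφr : ∀ x, φ x ∈ Set.Icc b (b + r)) (k j : ℕ)
    {Ω : Type*} [MeasurableSpace Ω] {P : Measure Ω} (μ ν : Ω → Measure X)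
    [∀ ω, IsProbabilityMeasure (μ ω)] [∀ ω, IsProbabilityMeasure (ν ω)]
    (hμ : ∀ h, IsTestFunction h → Measurable fun ω => ∫ x, h x ∂(μ ω))
    (hν : ∀ h, IsTestFunction h → Measurable fun ω => ∫ x, h x ∂(ν ω)) {p c s : ℝ} (hp : 1 ≤ p)
    (h : ∀ h : X → ℝ, Measurable h → (∀ x, |h x| ≤ 1) →
      ∫⁻ ω, ENNReal.ofReal (|s * (∫ x, h x ∂(μ ω) - ∫ x, h x ∂(ν ω))| ^ p) ∂P ≤
        ENNReal.ofReal c) :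
    eLpNorm (fun ω => s * (∫ x, φ x ∂(flow f g k j (μ ω)) - ∫ x, φ x ∂(flow f g k j (ν ω))))
        (ENNReal.ofReal p) P ≤
      ENNReal.ofReal ((δ * ε) ^ 2 * r * (1 - (ε ^ 2)⁻¹) ^ j) *
        (2 * ENNReal.ofReal c ^ (1 / p)) := by
  obtain ⟨h₁, h₂, m₁, b₁, m₂, b₂, hle⟩ :=
    exists_abs_integral_flow_sub_le hg hpos hδ hε hgδ hf hφ hr hφr k j
  set K := (δ * ε) ^ 2 * r * (1 - (ε ^ 2)⁻¹) ^ j with hK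
  have hK0 : 0 ≤ K := mul_nonneg (by positivity)
    (pow_nonneg (sub_nonneg.2 (inv_le_one_of_one_le₀ (by nlinarith))) _)
  set D : (X → ℝ) → Ω → ℝ := fun h ω => s * (∫ x, h x ∂(μ ω) - ∫ x, h x ∂(ν ω)) with hD
  have hDm : ∀ h, IsTestFunction h → AEStronglyMeasurable (fun ω => ‖D h ω‖) P := fun h hh =>
    (((hμ h hh).sub (hν h hh)).const_mul s).norm.aestronglyMeasurable
  calc _ ≤ eLpNorm (fun ω => K * (‖D h₁ ω‖ + ‖D h₂ ω‖)) (ENNReal.ofReal p) P := by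
        refine eLpNorm_mono_real fun ω => ?_
        have := mul_le_mul_of_nonneg_left (hle (μ ω) (ν ω)) (abs_nonneg s)
        simp only [hD, Real.norm_eq_abs, abs_mul]
        calc _ ≤ _ := this
          _ = _ := by ring
    _ = ENNReal.ofReal K *
        eLpNorm ((fun ω => ‖D h₁ ω‖) + fun ω => ‖D h₂ ω‖) (ENNReal.ofReal p) P := by
        have := eLpNorm_const_smul K ((fun ω => ‖D h₁ ω‖) + fun ω => ‖D h₂ ω‖)
          (ENNReal.ofReal p) P
        rw [← ofReal_norm, Real.norm_of_nonneg hK0] at this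
        exact this
    _ ≤ _ := by
        gcongr
        refine (eLpNorm_add_le (hDm h₁ ⟨m₁, 1, b₁⟩) (hDm h₂ ⟨m₂, 1, b₂⟩)
          (by simpa using hp)).trans ?_
        rw [two_mul, eLpNorm_norm, eLpNorm_norm]
        exact add_le_add (eLpNorm_le_of_lintegral_rpow_le hp (h h₁ m₁ b₁))
          (eLpNorm_le_of_lintegral_rpow_le hp (h h₂ m₂ b₂))

namespace IsGroupedFilter

variable {M m : ℕ} {L : Fin (M * m) → Fin (M * m)} {π₀ : Measure X}
  {Ω : Type*} [MeasurableSpace Ω] {P : Measure Ω} {ζ : ℕ → Fin (M * m) → Ω → X}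

lemma measurable_integral_empirical (h : IsGroupedFilter π₀ f g M m L P ζ)
    (hg : ∀ n, IsTestFunction (g n)) (hpos : ∀ n x, 0 < g n x) (hM : 1 ≤ M) (hm : 1 ≤ m) (n : ℕ)
    {φ : X → ℝ} (hφ : IsTestFunction φ) :
    Measurable fun ω => ∫ x, φ x ∂(empirical g M m L (fun k i => ζ k i ω) n) := by
  simp only [integral_empirical hpos hM hm _ n hφ]
  exact (measurable_estimate (fun n => (hg n).measurable) n hφ.measurable).comp
    (measurable_pi_lambda _ fun k => measurable_pi_lambda _ fun i => h.measurable k i)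

lemma measurable_integral_flow_empirical [IsMarkovKernel f]
    (h : IsGroupedFilter π₀ f g M m L P ζ) (hg : ∀ n, IsTestFunction (g n))
    (hpos : ∀ n x, 0 < g n x) (hM : 1 ≤ M) (hm : 1 ≤ m) (n k j : ℕ)
    {φ : X → ℝ} (hφ : IsTestFunction φ) :
    Measurable fun ω =>
      ∫ x, φ x ∂(flow f g k j (empirical g M m L (fun k i => ζ k i ω) n)) := by
  have : ∀ ω, IsProbabilityMeasure (empirical g M m L (fun k i => ζ k i ω) n) :=
    fun ω => isProbabilityMeasure_empirical hpos hM hm _ n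
  simp only [integral_flow hg hpos hφ]
  exact (h.measurable_integral_empirical hg hpos hM hm n (.fkIter hg hφ _ _)).div
    (h.measurable_integral_empirical hg hpos hM hm n (.fkIter hg (.const 1) _ _))

/-- The error of the flow started from the empirical measure at time `k` is of order `M ^ (-1/2)`,
with a geometric gain in the number `j` of further steps. The gain pays for the sampling error of
each new step: `ρ ^ j + ρ ^ (j + 1) / (1 - ρ) = ρ ^ j / (1 - ρ)`. -/
lemma eLpNorm_flow_empirical_sub_le [IsMarkovKernel f] [IsProbabilityMeasure π₀]
    [IsProbabilityMeasure P] (h : IsGroupedFilter π₀ f g M m L P ζ) (hL : Function.Bijective L)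
    (hg : ∀ n, IsTestFunction (g n)) (hpos : ∀ n x, 0 < g n x) {δ ε : ℝ} (hδ : 1 ≤ δ) (hε : 1 < ε)
    (hgδ : ∀ n x y, g n x ≤ δ * g n y) (hf : ∀ x y, f x ≤ ENNReal.ofReal ε • f y)
    {φ : X → ℝ} (hφ : IsTestFunction φ) {b r : ℝ} (hr : 0 < r)
    (hφr : ∀ x, φ x ∈ Set.Icc b (b + r)) {p : ℝ} (hp : 1 ≤ p) (hM : 1 ≤ M) (hm : 1 ≤ m)
    (k j : ℕ) :
    eLpNorm (fun ω => √(M : ℝ) * (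
      ∫ x, φ x ∂(flow f g k j (empirical g M m L (fun k i => ζ k i ω) k)) -
        ∫ x, φ x ∂(flow f g k j (predictionFilter π₀ f g k)))) (ENNReal.ofReal p) P ≤
      ENNReal.ofReal ((δ * ε) ^ 2 * r * (1 - (ε ^ 2)⁻¹) ^ j / (ε ^ 2)⁻¹) *
        (2 * ENNReal.ofReal (momentBound p) ^ (1 / p)) := by
  have : Nonempty X := π₀.nonempty_of_neZero
  have hp0 : 0 ≤ p := by linarith
  have hprob : ∀ k ω, IsProbabilityMeasure (empirical g M m L (fun k i => ζ k i ω) k) :=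
    fun k ω => isProbabilityMeasure_empirical hpos hM hm _ k
  have hε2 : 1 < ε ^ 2 := by nlinarith
  have hρ0 : 0 ≤ 1 - (ε ^ 2)⁻¹ := sub_nonneg.2 (inv_le_one_of_one_le₀ hε2.le)
  have hinv : 0 < (ε ^ 2)⁻¹ := by positivity
  induction k generalizing j with
  | zero =>
    refine (eLpNorm_integral_flow_sub_le hg hpos hδ hε hgδ hf hφ hr hφr 0 j
      (fun ω => empirical g M m L (fun k i => ζ k i ω) 0) (fun _ => π₀)
      (fun h' hh' => h.measurable_integral_empirical hg hpos hM hm 0 hh')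
      (fun _ _ => measurable_const) hp
      fun h' hm' hb' => h.lintegral_empirical_zero_le hpos hM hm hm' hb' hp0).trans ?_
    gcongr
    exact le_div_self (by positivity) hinv (inv_le_one_of_one_le₀ hε2.le)
  | succ k ih =>
    have hprob' : ∀ ω, IsProbabilityMeasure
        (filterStep f (g k) (empirical g M m L (fun k i => ζ k i ω) k)) :=
      fun ω => isProbabilityMeasure_filterStep (hg k) (hpos k) _
    have step := eLpNorm_integral_flow_sub_le hg hpos hδ hε hgδ hf hφ hr hφr (k + 1) j
      (fun ω => empirical g M m L (fun k i => ζ k i ω) (k + 1))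
      (fun ω => filterStep f (g k) (empirical g M m L (fun k i => ζ k i ω) k))
      (fun h' hh' => h.measurable_integral_empirical hg hpos hM hm (k + 1) hh')
      (fun h' hh' => h.measurable_integral_flow_empirical hg hpos hM hm k k 1 hh') hp
      fun h' hm' hb' => h.lintegral_empirical_succ_le hL hg hpos hM hm hm' hb' hp0 k
    have m1 := h.measurable_integral_flow_empirical hg hpos hM hm (k + 1) (k + 1) j hφ
    have m2 := h.measurable_integral_flow_empirical hg hpos hM hm k k (j + 1) hφ
    -- The error made by sampling at time `k + 1`, plus the propagated error of time `k`.
    have split : (fun ω => √(M : ℝ) * (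
        ∫ x, φ x ∂(flow f g (k + 1) j (empirical g M m L (fun k i => ζ k i ω) (k + 1))) -
          ∫ x, φ x ∂(flow f g (k + 1) j (predictionFilter π₀ f g (k + 1))))) =
        (fun ω => √(M : ℝ) * (
          ∫ x, φ x ∂(flow f g (k + 1) j (empirical g M m L (fun k i => ζ k i ω) (k + 1))) -
          ∫ x, φ x ∂(flow f g k (j + 1) (empirical g M m L (fun k i => ζ k i ω) k)))) +
        fun ω => √(M : ℝ) * (
          ∫ x, φ x ∂(flow f g k (j + 1) (empirical g M m L (fun k i => ζ k i ω) k)) -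
          ∫ x, φ x ∂(flow f g k (j + 1) (predictionFilter π₀ f g k))) := by
      ext ω
      simp only [Pi.add_apply, flow, predictionFilter]
      ring
    rw [split]
    refine (eLpNorm_add_le ((m1.sub m2).const_mul _).aestronglyMeasurable
      ((m2.sub_const _).const_mul _).aestronglyMeasurable (by simpa using hp)).trans ?_
    refine (add_le_add step (ih (j + 1))).trans (le_of_eq ?_)
    rw [← add_mul, ← ENNReal.ofReal_add (by positivity) (by positivity)]
    congr 2
    have hc := hinv.ne'
    generalize (ε ^ 2)⁻¹ = c at hc ⊢
    rw [pow_succ]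
    field_simp
    ring

/-- The uniform `L^p` bound for the particle filter with a bijective index map. The constant depends
neither on the number of particles nor on the index map. -/
lemma exists_forall_eLpNorm_estimate_sub_le {m : ℕ} [IsMarkovKernel f] [IsProbabilityMeasure π₀]
    (hg : ∀ n, IsTestFunction (g n)) (hpos : ∀ n x, 0 < g n x) (hmix : StrongMixing f g)
    (hm : 1 ≤ m) {φ : X → ℝ} (hφ : IsTestFunction φ) {p : ℝ} (hp : 1 ≤ p) :
    ∃ C : ℝ≥0, ∀ M : ℕ, 1 ≤ M → ∀ L : Fin (M * m) → Fin (M * m), Function.Bijective L →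
      ∀ (Ω : Type*) [MeasurableSpace Ω] (P : Measure Ω) [IsProbabilityMeasure P]
        (ζ : ℕ → Fin (M * m) → Ω → X), IsGroupedFilter π₀ f g M m L P ζ →
      ∀ n : ℕ, ENNReal.ofReal (√(M : ℝ)) *
        eLpNorm (fun ω => estimate g M m L (fun k i => ζ k i ω) n φ
          - ∫ x, φ x ∂(predictionFilter π₀ f g n)) (ENNReal.ofReal p) P ≤ C := by
  obtain ⟨δ, ε, hδ, hε, hgδ, hf⟩ := hmix
  obtain ⟨B, hB⟩ := hφ.bounded
  have hB0 : 0 ≤ B := (abs_nonneg _).trans (hB π₀.nonempty_of_neZero.some)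
  have hgδ' : ∀ n x y, g n x ≤ δ * g n y := fun n x y => (div_le_iff₀ (hpos n y)).1 (hgδ n x y)
  -- Enlarging `ε` makes the contraction factor `1 - ε⁻²` positive.
  have hf' : ∀ x y, f x ≤ ENNReal.ofReal (ε + 1) • f y := fun x y A =>
    (hf x y A).trans <| by
      simp only [Measure.smul_apply, smul_eq_mul]
      gcongr
      linarith
  have hφr : ∀ x, φ x ∈ Set.Icc (-B) (-B + (2 * B + 1)) := fun x => by
    have := abs_le.1 (hB x)
    exact ⟨this.1, by linarith⟩
  have hfin : ENNReal.ofReal ((δ * (ε + 1)) ^ 2 * (2 * B + 1) * (1 - ((ε + 1) ^ 2)⁻¹) ^ 0 /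
      ((ε + 1) ^ 2)⁻¹) * (2 * ENNReal.ofReal (momentBound p) ^ (1 / p)) ≠ ∞ :=
    ENNReal.mul_ne_top ENNReal.ofReal_ne_top (ENNReal.mul_ne_top (by simp)
      (ENNReal.rpow_ne_top_of_nonneg (by positivity) ENNReal.ofReal_ne_top))
  obtain ⟨C, hC⟩ : ∃ C : ℝ≥0, (C : ℝ≥0∞) = _ := ⟨_, ENNReal.coe_toNNReal hfin⟩
  refine ⟨C, fun M hM L hL Ω _ P _ ζ h n => ?_⟩
  rw [hC]
  have key := h.eLpNorm_flow_empirical_sub_le hL hg hpos hδ (by linarith) hgδ' hf' hφ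
    (by linarith) hφr hp hM hm n 0
  simp only [flow, integral_empirical hpos hM hm _ n hφ] at key
  have e := eLpNorm_const_smul (√(M : ℝ)) (fun ω => estimate g M m L (fun k i => ζ k i ω) n φ
    - ∫ x, φ x ∂(predictionFilter π₀ f g n)) (ENNReal.ofReal p) P
  rw [← ofReal_norm, Real.norm_of_nonneg (Real.sqrt_nonneg _)] at e
  rw [← e]
  exact key

end IsGroupedFilter

end

end ParticleFilter

open ParticleFilter in
theorem mainTheorem3 {X : Type*} [TopologicalSpace X] [PolishSpace X] [MeasurableSpace X]
    [BorelSpace X] (π₀ : Measure X) [IsProbabilityMeasure π₀]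
    (f : Kernel X X) [IsMarkovKernel f] (g : ℕ → X → ℝ)
    (hg_meas : ∀ n, Measurable (g n)) (hg_bdd : ∀ n, ∃ B : ℝ, ∀ x, g n x ≤ B)
    (hg_pos : ∀ n x, 0 < g n x) (hmix : StrongMixing f g) (m : ℕ) (hm : 1 ≤ m) :
    (∀ φ : X → ℝ, Measurable φ → (∃ B : ℝ, ∀ x, |φ x| ≤ B) → ∀ p : ℝ, 1 ≤ p →
      (∃ C : ℝ≥0, ∀ M θ : ℕ, 1 ≤ θ → θ < M →
        ∀ (Ω : Type*) [MeasurableSpace Ω] (P : Measure Ω) [IsProbabilityMeasure P]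
          (ζ : ℕ → Fin (M * m) → Ω → X), IsLEPF π₀ f g M m θ P ζ →
        ∀ n : ℕ, ENNReal.ofReal (√(M : ℝ)) *
          eLpNorm (fun ω => estimate g M m (localExchange M m θ) (fun k i => ζ k i ω) n φ
            - ∫ x, φ x ∂(predictionFilter π₀ f g n)) (ENNReal.ofReal p) P ≤ C) ∧
      (∃ C : ℝ≥0, ∀ M : ℕ, 1 ≤ M →
        ∀ (Ω : Type*) [MeasurableSpace Ω] (P : Measure Ω) [IsProbabilityMeasure P]
          (ζ : ℕ → Fin (M * m) → Ω → X), IsIBPF π₀ f g M m P ζ →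
        ∀ n : ℕ, ENNReal.ofReal (√(M : ℝ)) *
          eLpNorm (fun ω => estimate g M m id (fun k i => ζ k i ω) n φ
            - ∫ x, φ x ∂(predictionFilter π₀ f g n)) (ENNReal.ofReal p) P ≤ C)) ∧
    (∀ (M : ℕ) (z : ℕ → Fin (M * m) → X) (n : ℕ),
      (∀ θ : ℕ, 1 ≤ θ → θ < M →
        1 / (m : ℝ) ≤ effectiveFraction g M m (localExchange M m θ) z n) ∧
      (1 ≤ M → 1 / (m : ℝ) ≤ effectiveFraction g M m id z n)) := by

  have hg : ∀ n, IsTestFunction (g n) := fun n => by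
    obtain ⟨B, hB⟩ := hg_bdd n
    exact ⟨hg_meas n, B, fun x => (abs_of_pos (hg_pos n x)).trans_le (hB x)⟩
  refine ⟨fun φ hφ hφb p hp => ⟨?_, ?_⟩, fun M z n => ⟨fun θ h1 h2 => ?_, fun hM => ?_⟩⟩
  · obtain ⟨C, hC⟩ := IsGroupedFilter.exists_forall_eLpNorm_estimate_sub_le (π₀ := π₀)
      hg hg_pos hmix hm ⟨hφ, hφb⟩ hp
    exact ⟨C, fun M θ h1 h2 Ω _ P _ ζ h n =>
      hC M (by omega) _ (localExchange_bijective M m θ) Ω P ζ h n⟩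
  · obtain ⟨C, hC⟩ := IsGroupedFilter.exists_forall_eLpNorm_estimate_sub_le (π₀ := π₀)
      hg hg_pos hmix hm ⟨hφ, hφb⟩ hp
    exact ⟨C, fun M hM Ω _ P _ ζ h n => hC M hM id Function.bijective_id Ω P ζ h n⟩
  · exact one_div_le_effectiveFraction hg_pos (by omega) hm z n
  · exact one_div_le_effectiveFraction hg_pos hM hm z n
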